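/- For a positive integer $m$ and two multisets $A=\{u_1,\dots,u_m\}$, $B=\{v_1,\dots,v_m\}$ of complex numbers, let \[ d_F(A,B)=\min_{\sigma}\ \max_{1\le k\le m}|u_k-v_{\sigma(k)}| \] be their Fréchet distance, where $\sigma$ runs over all permutations of $\{1,\dots,m\}$. For a nonconstant complex polynomial $f$ let $Z(f)$ be the multiset of its complex roots, counted with multiplicity, and for $\alpha\in\mathbb C$ let $(S(\alpha)f)(z)=f(\alpha+z)$. Let $n\ge 2$ be an integer and let $a_1,\dots,a_{n-1}$ be fixed complex numbers. For $a\in\mathbb C$ set \[ g_a(z)=z^n+a^n\quad\text{and}\quad f_a(z)=z^n+a_{n-1}z^{n-1}+\cdots+a_1z+a^n . \] Then $S(a_{n-1}/n)g_a$ and $f_a$ have the same number of roots, counted with multiplicity, so that the following distance is defined, and \[ \lim_{|a|\to+\infty} d_F\bigl(Z(S(a_{n-1}/n)\,g_a),\,Z(f_a)\bigr)=0 . \] -/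

import Mathlib

open Polynomial Filter Topology

noncomputable section

/-- The Fréchet distance `min_σ max_k |u k - v (σ k)|` of two `m`-tuples of complex numbers.
The infimum and the supremum are over finite index sets, so for `m > 0` they are a minimum and
a maximum (see `frechetDist_isLeast`). -/
def frechetDist {m : ℕ} (u v : Fin m → ℂ) : ℝ :=
  ⨅ σ : Equiv.Perm (Fin m), ⨆ k : Fin m, ‖u k - v (σ k)‖

/-- The Fréchet distance of two multisets of the same cardinality: enumerate both of them.
It does not depend on the enumerations, see `multisetFrechetDist_eq`. -/
def multisetFrechetDist (A B : Multiset ℂ) (h : A.card = B.card) : ℝ :=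
  frechetDist (m := A.card)
    (fun k => A.toList.get (k.cast (Multiset.length_toList A).symm))
    (fun k => B.toList.get (k.cast (h.trans (Multiset.length_toList B).symm)))

/-- The translation operator `(S(α) f)(z) = f(α + z)`. -/
def shiftOp (α : ℂ) (f : ℂ[X]) : ℂ[X] := f.comp (C α + X)

/-- `z ^ n + a ^ n`. -/
def gPoly (n : ℕ) (a : ℂ) : ℂ[X] := X ^ n + C (a ^ n)

/-- `z ^ n + c (n-1) z ^ (n-1) + ⋯ + c 1 z + a ^ n`; only `c 1, …, c (n-1)` are used. -/
def fPoly (n : ℕ) (c : ℕ → ℂ) (a : ℂ) : ℂ[X] :=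
  X ^ n + (∑ k ∈ Finset.Icc 1 (n - 1), C (c k) * X ^ k) + C (a ^ n)

theorem frechetDist_isLeast {m : ℕ} (hm : 0 < m) (u v : Fin m → ℂ) :
    IsLeast {r : ℝ | ∃ σ : Equiv.Perm (Fin m),
      IsGreatest (Set.range fun k => ‖u k - v (σ k)‖) r} (frechetDist u v) := by
  have : Nonempty (Fin m) := ⟨⟨0, hm⟩⟩
  have hg : ∀ σ : Equiv.Perm (Fin m), IsGreatest (Set.range fun k => ‖u k - v (σ k)‖)
      (⨆ k : Fin m, ‖u k - v (σ k)‖) := fun σ =>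
    ⟨(Set.range_nonempty _).csSup_mem (Set.finite_range _),
      fun _ hx => le_csSup (Set.finite_range _).bddAbove hx⟩
  constructor
  · obtain ⟨σ, hσ⟩ := (Set.range_nonempty fun σ : Equiv.Perm (Fin m) =>
      ⨆ k : Fin m, ‖u k - v (σ k)‖).csInf_mem (Set.finite_range _)
    refine ⟨σ, ?_⟩
    have h := hg σ
    simp only at hσ
    rw [hσ] at h
    exact h
  · rintro r ⟨σ, hr⟩
    rw [hr.unique (hg σ)]
    exact ciInf_le (Set.finite_range _).bddBelow σ

theorem frechetDist_comp_perm {m : ℕ} (u v : Fin m → ℂ) (p q : Equiv.Perm (Fin m)) :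
    frechetDist (u ∘ p) (v ∘ q) = frechetDist u v := by
  unfold frechetDist
  refine Equiv.iInf_congr ((Equiv.mulLeft q).trans (Equiv.mulRight p⁻¹)) fun σ => ?_
  refine (Equiv.iSup_congr p fun k => ?_).symm
  simp

theorem multisetFrechetDist_eq {m : ℕ} (u v : Fin m → ℂ) (A B : Multiset ℂ)
    (h : A.card = B.card) (hu : Finset.univ.val.map u = A) (hv : Finset.univ.val.map v = B) :
    multisetFrechetDist A B h = frechetDist u v := by
  have hm : m = A.card := by rw [← hu]; simp
  subst hm
  have key : ∀ (w w' : Fin A.card → ℂ),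
      Finset.univ.val.map w = Finset.univ.val.map w' →
      ∃ p : Equiv.Perm (Fin A.card), w = w' ∘ p := by
    classical
    intro w w' hw
    have hc : ∀ z : ℂ, Nonempty ({k // w k = z} ≃ {k // w' k = z}) := by
      intro z
      refine ⟨Fintype.equivOfCardEq ?_⟩
      have h1 := congrArg (Multiset.count z) hw
      rw [Multiset.count_map, Multiset.count_map] at h1
      rw [Fintype.card_subtype, Fintype.card_subtype]
      simpa [Finset.card, eq_comm] using h1
    have e := fun z => Classical.choice (hc z)
    refine ⟨(Equiv.sigmaFiberEquiv w).symm.trans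
      ((Equiv.sigmaCongrRight e).trans (Equiv.sigmaFiberEquiv w')), ?_⟩
    funext k
    exact ((e (w k)) ⟨k, rfl⟩).2.symm
  have en : ∀ (D : Multiset ℂ) (hD : A.card = D.toList.length),
      Finset.univ.val.map (fun k : Fin A.card => D.toList.get (k.cast hD)) = D := by
    intro D hD
    rw [Fin.univ_def]
    simp only [Multiset.map_coe]
    conv_rhs => rw [← Multiset.coe_toList D]
    congr 1
    rw [← List.ofFn_eq_map]
    generalize D.toList = l at hD
    generalize A.card = j at hD
    subst hD
    simp
  obtain ⟨p, hp⟩ := key _ u ((en A (Multiset.length_toList A).symm).trans hu.symm)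
  obtain ⟨q, hq⟩ := key _ v ((en B (h.trans (Multiset.length_toList B).symm)).trans hv.symm)
  unfold multisetFrechetDist
  rw [hp, hq, frechetDist_comp_perm]

end

/-! Put `s = c (n - 1) / n`. The roots of the shifted `gPoly` are `a * ω - s` with `ω ^ n = -1`. At
such a point the shift by `s` cancels the `a ^ (n - 1)` term of `fPoly`, so the value is `o(a ^ (n -
1))`, while the derivative is asymptotic to `n * (a * ω) ^ (n - 1)`. Since some root lies within `n`
times the Newton quotient, `fPoly` has a root at distance `o(1)`. The points `a * ω - s` move apart
linearly in `‖a‖`, so the `n` roots so found are distinct and exhaust the roots of `fPoly`; pairing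
each with its point bounds the distance. -/

/-- A complex polynomial has a root within `deg p * ‖p x / p' x‖` of any point `x`. -/
theorem exists_root_norm_sub_le (p : ℂ[X]) (x : ℂ) (hx : p.derivative.eval x ≠ 0) :
    ∃ r, p.IsRoot r ∧
      ‖x - r‖ ≤ p.natDegree * (‖p.eval x‖ / ‖p.derivative.eval x‖) := by
  have hp : p ≠ 0 := by rintro rfl; simp at hx
  have hs : p.Splits := IsAlgClosed.splits p
  by_cases h0 : p.eval x = 0
  · exact ⟨x, h0, by simp [h0]⟩
  by_contra! hcon
  set D := p.natDegree * (‖p.eval x‖ / ‖p.derivative.eval x‖) with hD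
  have hcard : p.roots.card = p.natDegree := hs.natDegree_eq_card_roots.symm
  have hdeg : 0 < p.natDegree := by
    rcases Nat.eq_zero_or_pos p.natDegree with h | h
    · rw [Polynomial.eq_C_of_natDegree_eq_zero h] at hx
      simp at hx
    · exact h
  have hDpos : 0 < D := by
    have := norm_pos_iff.2 h0
    have := norm_pos_iff.2 hx
    positivity
  -- The logarithmic derivative is `p' / p = ∑ 1 / (x - z)` over the roots. If all roots were
  -- farther than `D`, its norm would be below `deg p / D`, which is exactly `‖p' x / p x‖`.
  have hsum := hs.eval_derivative_div_eval_of_ne_zero h0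
  have hne : p.roots ≠ 0 := by
    intro h
    rw [h] at hcard
    simp at hcard
    omega
  have hlt : ‖(p.roots.map fun z => 1 / (x - z)).sum‖ < p.natDegree * D⁻¹ := by
    calc ‖(p.roots.map fun z => 1 / (x - z)).sum‖
        ≤ (p.roots.map fun z => ‖1 / (x - z)‖).sum := by
          simpa using norm_multiset_sum_le (p.roots.map fun z => 1 / (x - z))
      _ < (p.roots.map fun _ => D⁻¹).sum := by
          refine Multiset.sum_lt_sum_of_nonempty hne fun z hz => ?_
          rw [norm_div, norm_one, one_div]
          exact inv_strictAnti₀ hDpos (hcon z (Polynomial.isRoot_of_mem_roots hz))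
      _ = p.natDegree * D⁻¹ := by simp [hcard]
  rw [← hsum, norm_div, hD] at hlt
  have h1 := norm_pos_iff.2 h0
  have h2 := norm_pos_iff.2 hx
  have h3 : (0 : ℝ) < p.natDegree := by exact_mod_cast hdeg
  refine absurd hlt (not_lt.2 (le_of_eq ?_))
  field_simp

/-- As many distinct roots as the degree leave no room for others or for multiplicities. -/
theorem roots_eq_map_of_injective {n : ℕ} {p : ℂ[X]} (hp : p ≠ 0) (hn : p.natDegree = n)
    {v : Fin n → ℂ} (hv : Function.Injective v) (hr : ∀ k, p.IsRoot (v k)) :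
    Finset.univ.val.map v = p.roots := by
  refine Multiset.eq_of_le_of_card_le ?_ ?_
  · rw [Multiset.le_iff_subset (Finset.univ.nodup.map hv)]
    intro z hz
    obtain ⟨k, -, rfl⟩ := Multiset.mem_map.1 hz
    exact (Polynomial.mem_roots hp).2 (hr k)
  · simpa [hn] using Polynomial.card_roots' p

theorem monic_fPoly_natDegree {n : ℕ} (hn : 2 ≤ n) (c : ℕ → ℂ) (a : ℂ) :
    (fPoly n c a).Monic ∧ (fPoly n c a).natDegree = n := by
  have hlt : ((∑ k ∈ Finset.Icc 1 (n - 1), C (c k) * X ^ k) + C (a ^ n)).degree < n := by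
    refine (Polynomial.degree_add_le _ _).trans_lt (max_lt ?_ ?_)
    · refine (Polynomial.degree_sum_le _ _).trans_lt ?_
      rw [Finset.sup_lt_iff (by exact_mod_cast WithBot.bot_lt_coe n)]
      intro k hk
      refine (Polynomial.degree_C_mul_X_pow_le k (c k)).trans_lt ?_
      have := (Finset.mem_Icc.1 hk)
      exact_mod_cast (by omega : k < n)
    · exact Polynomial.degree_C_le.trans_lt (by exact_mod_cast (by omega : 0 < n))
  rw [fPoly, add_assoc]
  exact ⟨Polynomial.monic_X_pow_add hlt, by
    rw [Polynomial.natDegree_add_eq_left_of_degree_lt (by simpa using hlt)]; simp⟩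

theorem natDegree_shiftOp (α : ℂ) (f : ℂ[X]) : (shiftOp α f).natDegree = f.natDegree := by
  rw [shiftOp, add_comm, Polynomial.natDegree_comp, Polynomial.natDegree_X_add_C, mul_one]

theorem natDegree_gPoly (n : ℕ) (a : ℂ) : (gPoly n a).natDegree = n :=
  Polynomial.natDegree_X_pow_add_C

theorem eval_fPoly (n : ℕ) (c : ℕ → ℂ) (a x : ℂ) :
    (fPoly n c a).eval x = x ^ n + ∑ k ∈ Finset.Icc 1 (n - 1), c k * x ^ k + a ^ n := by
  simp [fPoly, Polynomial.eval_finsetSum]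

theorem eval_derivative_fPoly (n : ℕ) (c : ℕ → ℂ) (a x : ℂ) :
    (fPoly n c a).derivative.eval x =
      n * x ^ (n - 1) + ∑ k ∈ Finset.Icc 1 (n - 1), c k * (k * x ^ (k - 1)) := by
  simp [fPoly, Polynomial.eval_finsetSum, -map_pow,
    Polynomial.derivative_X_pow]

theorem exists_injective_pow_eq_neg_one {n : ℕ} (hn : 2 ≤ n) :
    ∃ ω : Fin n → ℂ, Function.Injective ω ∧ ∀ k, ω k ^ n = -1 := by
  have h0 : n ≠ 0 := by omega
  obtain ⟨η, hη⟩ := IsAlgClosed.exists_pow_nat_eq (-1 : ℂ) (Nat.pos_of_ne_zero h0)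
  have hη0 : η ≠ 0 := by rintro rfl; simp [h0] at hη
  have hζ := Complex.isPrimitiveRoot_exp n h0
  refine ⟨fun k => Complex.exp (2 * Real.pi * Complex.I / n) ^ (k : ℕ) * η, ?_, fun k => ?_⟩
  · intro i j hij
    exact Fin.ext (hζ.pow_inj i.2 j.2 (mul_right_cancel₀ hη0 hij))
  · rw [mul_pow, ← pow_mul, mul_comm (k : ℕ), pow_mul, hζ.pow_eq_one, one_pow, one_mul, hη]

theorem tendsto_sub_mul_inv (ω s : ℂ) :
    Tendsto (fun a : ℂ => ω - s * a⁻¹) (Bornology.cobounded ℂ) (𝓝 ω) := by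
  simpa using (tendsto_const_nhds (x := ω)).sub
    ((tendsto_inv₀_cobounded (α := ℂ)).const_mul s)

/-- Write the point as `a * y` with `y = ω - s / a`. Then `(a * y) ^ n + a ^ n = a ^ n * (y ^ n - ω
^ n)`, and factoring out `y - ω = -s / a` leaves `-s * n * ω ^ (n - 1)` in the limit. This cancels
the limit `c (n - 1) * ω ^ (n - 1)` of the other terms, which dictates the choice of `s`. -/
theorem tendsto_eval_fPoly_div {n : ℕ} (hn : 2 ≤ n) (c : ℕ → ℂ) {ω : ℂ} (hω : ω ^ n = -1) :
    Tendsto (fun a : ℂ => (fPoly n c a).eval (a * ω - c (n - 1) / n) / a ^ (n - 1))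
      (Bornology.cobounded ℂ) (𝓝 0) := by
  set s := c (n - 1) / n with hs
  have hy := tendsto_sub_mul_inv ω s
  have hb : Tendsto (fun a : ℂ => a⁻¹) (Bornology.cobounded ℂ) (𝓝 0) := tendsto_inv₀_cobounded
  have hlim : Tendsto (fun a : ℂ =>
      (∑ i ∈ Finset.range n, (ω - s * a⁻¹) ^ i * ω ^ (n - 1 - i)) * (-s) +
        ∑ k ∈ Finset.Icc 1 (n - 1), c k * ((ω - s * a⁻¹) ^ k * a⁻¹ ^ (n - 1 - k)))
      (Bornology.cobounded ℂ)
      (𝓝 ((∑ i ∈ Finset.range n, ω ^ i * ω ^ (n - 1 - i)) * (-s) +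
        ∑ k ∈ Finset.Icc 1 (n - 1), c k * (ω ^ k * 0 ^ (n - 1 - k)))) :=
    ((tendsto_finsetSum _ fun i _ => (hy.pow i).mul_const _).mul_const _).add
      (tendsto_finsetSum _ fun k _ => ((hy.pow k).mul (hb.pow _)).const_mul _)
  have hval : (∑ i ∈ Finset.range n, ω ^ i * ω ^ (n - 1 - i)) * (-s) +
      ∑ k ∈ Finset.Icc 1 (n - 1), c k * (ω ^ k * 0 ^ (n - 1 - k)) = 0 := by
    have h1 : ∑ i ∈ Finset.range n, ω ^ i * ω ^ (n - 1 - i) = n * ω ^ (n - 1) := by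
      rw [Finset.sum_congr rfl (g := fun _ => ω ^ (n - 1))]
      · simp
      · intro i hi
        have := Finset.mem_range.1 hi
        rw [← pow_add]
        congr 1
        omega
    have h2 : ∑ k ∈ Finset.Icc 1 (n - 1), c k * (ω ^ k * 0 ^ (n - 1 - k)) =
        c (n - 1) * ω ^ (n - 1) := by
      -- Only `k = n - 1` survives, through `0 ^ 0 = 1`.
      rw [Finset.sum_eq_single (n - 1)]
      · simp
      · intro k hk hne
        have := Finset.mem_Icc.1 hk
        rw [zero_pow (by omega)]
        simp
      · intro h
        exact absurd (Finset.mem_Icc.2 ⟨by omega, le_rfl⟩) h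
    have hn0 : (n : ℂ) ≠ 0 := by exact_mod_cast (by omega : n ≠ 0)
    rw [h1, h2, hs]
    field_simp
    ring
  rw [hval] at hlim
  refine hlim.congr' ?_
  filter_upwards [Bornology.eventually_ne_cobounded (0 : ℂ)] with a ha
  have hx : a * ω - s = a * (ω - s * a⁻¹) := by field_simp
  rw [eval_fPoly, hx]
  set y := ω - s * a⁻¹ with hydef
  have hpow : a ^ n = a * a ^ (n - 1) := by rw [← pow_succ']; congr 1; omega
  have ha' : a ^ (n - 1) ≠ 0 := pow_ne_zero _ ha
  have hmain : (∑ i ∈ Finset.range n, y ^ i * ω ^ (n - 1 - i)) * (-s) = a * (y ^ n + 1) := by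
    have := geom_sum₂_mul y ω n
    rw [hω] at this
    have hsy : -s = a * (y - ω) := by rw [hydef]; field_simp; ring
    rw [hsy]
    linear_combination a * this
  have hsum : ∑ k ∈ Finset.Icc 1 (n - 1), c k * (a * y) ^ k =
      a ^ (n - 1) * ∑ k ∈ Finset.Icc 1 (n - 1), c k * (y ^ k * a⁻¹ ^ (n - 1 - k)) := by
    rw [Finset.mul_sum]
    refine Finset.sum_congr rfl fun k hk => ?_
    have hk' : k ≤ n - 1 := (Finset.mem_Icc.1 hk).2
    rw [← pow_sub_mul_pow a hk', mul_pow, inv_pow]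
    field_simp
  rw [hmain, eq_div_iff ha', hsum, mul_pow, hpow]
  ring

/-- The lower terms have degree `k - 1 < n - 1` and vanish in the limit, so any shift `s` will do.
-/
theorem tendsto_eval_derivative_fPoly_div {n : ℕ} (c : ℕ → ℂ) (ω s : ℂ) :
    Tendsto (fun a : ℂ => (fPoly n c a).derivative.eval (a * ω - s) / a ^ (n - 1))
      (Bornology.cobounded ℂ) (𝓝 (n * ω ^ (n - 1))) := by
  have hy := tendsto_sub_mul_inv ω s
  have hb : Tendsto (fun a : ℂ => a⁻¹) (Bornology.cobounded ℂ) (𝓝 0) := tendsto_inv₀_cobounded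
  have hlim : Tendsto (fun a : ℂ => n * (ω - s * a⁻¹) ^ (n - 1) +
        ∑ k ∈ Finset.Icc 1 (n - 1),
          c k * (k * ((ω - s * a⁻¹) ^ (k - 1) * a⁻¹ ^ (n - 1 - (k - 1)))))
      (Bornology.cobounded ℂ)
      (𝓝 (n * ω ^ (n - 1) +
        ∑ k ∈ Finset.Icc 1 (n - 1), c k * (k * (ω ^ (k - 1) * 0 ^ (n - 1 - (k - 1)))))) :=
    ((hy.pow _).const_mul _).add
      (tendsto_finsetSum _ fun k _ =>
        (((hy.pow _).mul (hb.pow _)).const_mul _).const_mul _)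
  have hval : ∑ k ∈ Finset.Icc 1 (n - 1),
      c k * (k * (ω ^ (k - 1) * 0 ^ (n - 1 - (k - 1)))) = 0 := by
    refine Finset.sum_eq_zero fun k hk => ?_
    have := Finset.mem_Icc.1 hk
    rw [zero_pow (by omega)]
    simp
  rw [hval, add_zero] at hlim
  refine hlim.congr' ?_
  filter_upwards [Bornology.eventually_ne_cobounded (0 : ℂ)] with a ha
  have hx : a * ω - s = a * (ω - s * a⁻¹) := by field_simp
  rw [eval_derivative_fPoly, hx]
  set y := ω - s * a⁻¹
  rw [eq_div_iff (pow_ne_zero _ ha), add_mul, Finset.sum_mul, mul_pow]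
  congr 1
  · ring
  · refine Finset.sum_congr rfl fun k hk => ?_
    have hk' : k - 1 ≤ n - 1 := by have := Finset.mem_Icc.1 hk; omega
    rw [← pow_sub_mul_pow a hk', mul_pow, inv_pow]
    field_simp

/-- Near each root of the shifted `gPoly` there is eventually a root of `fPoly`. -/
theorem eventually_exists_root_fPoly {n : ℕ} (hn : 2 ≤ n) (c : ℕ → ℂ) {ω : ℂ}
    (hω : ω ^ n = -1) {ε : ℝ} (hε : 0 < ε) :
    ∀ᶠ a in Bornology.cobounded ℂ, ∃ r, (fPoly n c a).IsRoot r ∧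
      ‖a * ω - c (n - 1) / n - r‖ < ε := by
  have hω0 : ω ≠ 0 := by
    rintro rfl
    simp [show n ≠ 0 by omega] at hω
  have hL : (n : ℂ) * ω ^ (n - 1) ≠ 0 :=
    mul_ne_zero (by exact_mod_cast (by omega : n ≠ 0)) (pow_ne_zero _ hω0)
  have h1 := tendsto_eval_fPoly_div hn c hω
  have h2 := tendsto_eval_derivative_fPoly_div (n := n) c ω (c (n - 1) / n)
  have h3 := ((h1.norm.div h2.norm (norm_ne_zero_iff.2 hL)).const_mul (n : ℝ))
  simp only [norm_zero, zero_div, mul_zero] at h3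
  filter_upwards [h3.eventually_lt_const hε, h2.eventually_ne hL,
    Bornology.eventually_ne_cobounded (0 : ℂ)] with a ha1 ha2 ha
  have ha' : a ^ (n - 1) ≠ 0 := pow_ne_zero _ ha
  obtain ⟨r, hr, hle⟩ := exists_root_norm_sub_le (fPoly n c a) (a * ω - c (n - 1) / n)
    (fun h => ha2 (by rw [h, zero_div]))
  refine ⟨r, hr, hle.trans_lt ?_⟩
  rw [(monic_fPoly_natDegree hn c a).2]
  rwa [Pi.div_apply, norm_div, norm_div, div_div_div_cancel_right₀ (norm_ne_zero_iff.2 ha')] at ha1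

theorem mainTheorem7 (n : ℕ) (hn : 2 ≤ n) (c : ℕ → ℂ) :
    ∃ h : ∀ a : ℂ,
        (shiftOp (c (n - 1) / n) (gPoly n a)).roots.card = (fPoly n c a).roots.card,
      Tendsto
        (fun a : ℂ => multisetFrechetDist
          (shiftOp (c (n - 1) / n) (gPoly n a)).roots (fPoly n c a).roots (h a))
        (comap (fun a : ℂ => ‖a‖) atTop) (𝓝 0) := by
  have hdeg : ∀ a, (shiftOp (c (n - 1) / n) (gPoly n a)).natDegree = n := fun a => by
    rw [natDegree_shiftOp, natDegree_gPoly]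
  refine ⟨fun a => ?_, ?_⟩
  · rw [← (IsAlgClosed.splits _).natDegree_eq_card_roots,
      ← (IsAlgClosed.splits _).natDegree_eq_card_roots, hdeg, (monic_fPoly_natDegree hn c a).2]
  obtain ⟨ω, hinj, hω⟩ := exists_injective_pow_eq_neg_one hn
  have hpos : 0 < n := by omega
  have : Nonempty (Fin n) := ⟨⟨0, hpos⟩⟩
  rw [show comap (fun a : ℂ => ‖a‖) atTop = Bornology.cobounded ℂ from comap_norm_atTop,
    Metric.tendsto_nhds]
  intro ε hε
  have hroot : ∀ᶠ a in Bornology.cobounded ℂ, ∀ k, ∃ r, (fPoly n c a).IsRoot r ∧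
      ‖a * ω k - c (n - 1) / n - r‖ < ε / 2 :=
    eventually_all.2 fun k => eventually_exists_root_fPoly hn c (hω k) (half_pos hε)
  -- A root shared by two of the points, each within `ε / 2` of it, would put them less than `ε`
  -- apart.
  have hsep : ∀ᶠ a in Bornology.cobounded ℂ, ∀ i j, i ≠ j → ε < ‖a‖ * ‖ω i - ω j‖ := by
    refine eventually_all.2 fun i => eventually_all.2 fun j => ?_
    by_cases hij : i = j
    · simp [hij]
    have hd : 0 < ‖ω i - ω j‖ := norm_pos_iff.2 (sub_ne_zero.2 (hinj.ne hij))
    filter_upwards [(tendsto_norm_cobounded_atTop.atTop_mul_const hd).eventually_gt_atTop ε]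
      with a ha _ using ha
  filter_upwards [hroot, hsep, Bornology.eventually_ne_cobounded (0 : ℂ)] with a hr hs ha
  choose v hv hclose using hr
  have hvinj : Function.Injective v := by
    intro i j hij
    by_contra hne
    refine absurd (hs i j hne) (not_lt.2 ?_)
    rw [← norm_mul, show a * (ω i - ω j) = (a * ω i - c (n - 1) / n - v i) -
      (a * ω j - c (n - 1) / n - v j) by rw [hij]; ring]
    linarith [norm_sub_le (a * ω i - c (n - 1) / n - v i) (a * ω j - c (n - 1) / n - v j),
      hclose i, hclose j]
  have hu := roots_eq_map_of_injective
    (p := shiftOp (c (n - 1) / n) (gPoly n a)) (v := fun k => a * ω k - c (n - 1) / n)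
    (Polynomial.ne_zero_of_natDegree_gt (n := 0) (by rw [hdeg]; exact hpos)) (hdeg a)
    (fun i j hij => hinj (mul_left_cancel₀ ha (sub_left_injective hij)))
    (fun k => by
      simp [Polynomial.IsRoot, shiftOp, gPoly, mul_pow, hω k])
  have hf := monic_fPoly_natDegree hn c a
  rw [multisetFrechetDist_eq _ _ _ _ _ hu
    (roots_eq_map_of_injective hf.1.ne_zero hf.2 hvinj hv), Real.dist_0_eq_abs]
  -- Attainment of the minimum serves only to show that the distance is nonnegative.
  obtain ⟨⟨σ, hσ⟩, hmin⟩ := frechetDist_isLeast hpos (fun k => a * ω k - c (n - 1) / n) v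
  obtain ⟨k, hk⟩ := hσ.1
  rw [abs_of_nonneg (by rw [← hk]; positivity)]
  have hle : (⨆ k, ‖a * ω k - c (n - 1) / n - v k‖) ≤ ε / 2 :=
    ciSup_le fun k => (hclose k).le
  -- `v` is already indexed by the nearby points, so the identity permutation suffices.
  refine lt_of_le_of_lt ((ciInf_le (Set.finite_range _).bddBelow 1).trans ?_) (half_lt_self hε)
  simpa using hle
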